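/- **Setting.** Let $\mu,\nu,r_0>0$, let $W$ be the principal branch of the Lambert function (the inverse of $s\mapsto se^s$ on $[-1,\infty)$), and assume $\mu W(1)^2/\nu>\tfrac14$, so that $\beta:=\sqrt{\mu W(1)^2/\nu-\tfrac14}>0$. Let $\theta:[0,\infty)\to\mathbb R$ be smooth with $\theta(0)=1$ and $\theta(r)=0$ for $r\ge r_0$, and put $$v(r)=\mu\,\mathcal E(r),\qquad \mathcal E(r)=-\frac{\big(W(e^{\theta(r)})-\theta(r)\big)^2}{\nu r^2}\qquad(r>0).$$ For $c\neq0$ and $\lambda\ge 0$ let $w_\lambda\in C^2([0,r_0])$ be the solution of $$w_\lambda''-(v+\lambda^2)w_\lambda=0\ \text{ on }(0,r_0],\qquad w_\lambda(0)=0,\quad w_\lambda'(0)=c .$$ Let $K_{i\beta}$ be the modified Bessel function of the second kind of order $i\beta$ and $\vartheta_\beta=\arg\Gamma(1+i\beta)\in(-\pi,\pi]$. Consider, for $\lambda>0$, the vanishing-determinant condition $D(\lambda)=0$, where $$D(\lambda):=\Big[\frac{w_\lambda(r_0)}2-r_0w_\lambda'(r_0)\Big]K_{i\beta}(\lambda r_0)+\lambda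 r_0\,w_\lambda(r_0)\,K_{i\beta}'(\lambda r_0).$$ Put $a=\tfrac12w_0(r_0)-r_0w_0'(r_0)$, $b=\beta w_0(r_0)$ (these are not both zero), let $$L(\lambda)=-a\sin\!\big(\vartheta_\beta-\beta\ln\tfrac{\lambda r_0}2\big)+b\cos\!\big(\vartheta_\beta-\beta\ln\tfrac{\lambda r_0}2\big),\qquad F_{r_0}(\lambda)=L(\lambda)+\sqrt{\tfrac{\beta\sinh(\pi\beta)}{\pi}}\;D(\lambda),$$ so that $D(\lambda)=0$ if and only if $L(\lambda)=F_{r_0}(\lambda)$. Let $\alpha\in(-\pi,\pi]$ be the angle with $\cos\alpha=a/\sqrt{a^2+b^2}$ and $\sin\alpha=b/\sqrt{a^2+b^2}$ (so $\alpha=\arctan\frac ba$ if $a>0$), and set $$\lambda_n^0=\tfrac2{r_0}\,e^{(\vartheta_\beta-\alpha)/\beta}\,e^{-n\pi/\beta},\qquad n\in\mathbb Z.$$ **Proposition.** There is $n_0\in\mathbb Z$, depending only on $v,r_0,\beta$ (in particular not on $c$), such that the following hold. 1. The solutions $\lambda>0$ of the unperturbed equation $L(\lambda)=0$ are exactly the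 numbers $\lambda_n^0$, $n\in\mathbb Z$. 2. For every $n\ge n_0$ the equation $$\sin\eta=\frac{(-1)^n}{\sqrt{a^2+b^2}}\,F_{r_0}\big(\lambda_n^0e^{\eta/\beta}\big)$$ has a unique solution $\eta_n\in(-\tfrac\pi2,\tfrac\pi2)$, and $\eta_n\to0$ as $n\to+\infty$. 3. For every $n\ge n_0$ the number $\lambda_n=\lambda_n^0e^{\eta_n/\beta}$ satisfies the vanishing-determinant condition $D(\lambda_n)=0$, and the set $\{\lambda_n:n\ge n_0\}$ is infinite. -/

import Mathlib

open Set Filter Topology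
open scoped ContDiff

noncomputable section

namespace Efimov

/-- The principal branch of the Lambert function: the inverse of `s ↦ s * exp s` on `[-1, ∞)`
(meaningful at arguments `x ≥ -1/e`). -/
def lambertW (x : ℝ) : ℝ :=
  Function.invFunOn (fun s : ℝ => s * Real.exp s) (Ici (-1)) x

/-- The parameter `β = √(μ W(1)² / ν - 1/4)`. -/
def betaParam (μ ν : ℝ) : ℝ :=
  Real.sqrt (μ * lambertW 1 ^ 2 / ν - 1 / 4)

/-- The Born-Oppenheimer potential `𝓔(r) = -(W(e^{θ(r)}) - θ(r))² / (ν r²)`, for `r > 0`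
(only positive arguments are used). -/
def effectiveEnergy (ν : ℝ) (θ : ℝ → ℝ) (r : ℝ) : ℝ :=
  -((lambertW (Real.exp (θ r)) - θ r) ^ 2 / (ν * r ^ 2))

/-- `w` is the solution in `C²([0, r₀])` of `w'' - (v + lam²) w = 0` on `(0, r₀]` with
`w(0) = 0` and `w'(0) = c`; derivatives on `[0, r₀]` are one-sided at the end points. -/
structure IsInnerSolution (v : ℝ → ℝ) (r₀ c lam : ℝ) (w : ℝ → ℝ) : Prop where
  contDiffOn : ContDiffOn ℝ 2 w (Icc 0 r₀)
  equation : ∀ r ∈ Ioc 0 r₀,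
    derivWithin (derivWithin w (Icc 0 r₀)) (Icc 0 r₀) r - (v r + lam ^ 2) * w r = 0
  map_zero : w 0 = 0
  deriv_zero : derivWithin w (Icc 0 r₀) 0 = c

/-- The modified Bessel function of the first kind,
`I_s(z) = (z/2)^s ∑ₖ (z²/4)^k / (k! Γ(s + k + 1))`, with the principal power. -/
def besselI (s z : ℂ) : ℂ :=
  (z / 2) ^ s * ∑' k : ℕ, (z ^ 2 / 4) ^ k / ((k.factorial : ℂ) * Complex.Gamma (s + k + 1))

/-- The modified Bessel function of the second kind (Macdonald function) of non-integer order,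
`K_s(z) = (π/2) (I_{-s}(z) - I_s(z)) / sin(π s)`. -/
def besselK (s z : ℂ) : ℂ :=
  (Real.pi / 2 : ℂ) * ((besselI (-s) z - besselI s z) / Complex.sin (Real.pi * s))

/-- The function `K_{iβ}` on the positive half-line, where it takes real values;
see `ofReal_macdonald`. -/
def macdonald (β x : ℝ) : ℝ :=
  (besselK (β * Complex.I) x).re

theorem conj_besselI (s : ℂ) {x : ℝ} (hx : 0 < x) :
    (starRingEnd ℂ) (besselI s x) = besselI ((starRingEnd ℂ) s) x := by
  have harg : ((x : ℂ) / 2).arg ≠ Real.pi := by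
    have : ((x : ℂ) / 2) = ((x / 2 : ℝ) : ℂ) := by push_cast; rfl
    rw [this, Complex.arg_ofReal_of_nonneg (by positivity)]
    exact Real.pi_pos.ne
  have h2 : (starRingEnd ℂ) ((x : ℂ) / 2) = (x : ℂ) / 2 := by
    rw [map_div₀, Complex.conj_ofReal, Complex.conj_ofNat]
  unfold besselI
  rw [map_mul, Complex.conj_tsum]
  congr 1
  · have h := Complex.cpow_conj ((x : ℂ) / 2) s harg
    rw [h2] at h
    exact h.symm
  · refine tsum_congr fun k => ?_
    have h := Complex.Gamma_conj (s + k + 1)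
    simp only [map_add, map_one, Complex.conj_natCast] at h
    rw [map_div₀, map_pow, map_div₀, map_pow, map_mul, Complex.conj_natCast, Complex.conj_ofReal,
      Complex.conj_ofNat, h]

/-- `K_{iβ}` is real-valued on the positive half-line. -/
theorem ofReal_macdonald (β : ℝ) {x : ℝ} (hx : 0 < x) :
    (macdonald β x : ℂ) = besselK (β * Complex.I) x := by
  unfold macdonald
  apply Complex.conj_eq_iff_re.mp
  unfold besselK
  simp only [map_mul, map_div₀, map_sub]
  rw [conj_besselI _ hx, conj_besselI _ hx]
  simp only [← Complex.sin_conj, map_neg, map_mul, Complex.conj_ofReal, Complex.conj_I,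
    Complex.conj_ofNat, mul_neg, neg_neg, Complex.sin_neg]
  rw [div_neg, ← neg_div, neg_sub]

/-- `ϑ_β = arg Γ(1 + iβ) ∈ (-π, π]`. -/
def gammaPhase (β : ℝ) : ℝ :=
  (Complex.Gamma (1 + β * Complex.I)).arg

/-- The determinant expressing the `C¹` matching at `r₀` of an inner solution `w` with the
decaying exterior solution `√r K_{iβ}(lam r)`:
`[w(r₀)/2 - r₀ w'(r₀)] K_{iβ}(lam r₀) + lam r₀ w(r₀) K_{iβ}'(lam r₀)`. -/
def matchingDet (β r₀ lam : ℝ) (w : ℝ → ℝ) : ℝ :=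
  (w r₀ / 2 - r₀ * derivWithin w (Icc 0 r₀) r₀) * macdonald β (lam * r₀) +
    lam * r₀ * w r₀ * deriv (macdonald β) (lam * r₀)

/-- `a = w₀(r₀)/2 - r₀ w₀'(r₀)`, for the inner solution `w₀` with `lam = 0`. -/
def coeffA (r₀ : ℝ) (w₀ : ℝ → ℝ) : ℝ :=
  w₀ r₀ / 2 - r₀ * derivWithin w₀ (Icc 0 r₀) r₀

/-- `b = β w₀(r₀)`, for the inner solution `w₀` with `lam = 0`. -/
def coeffB (β r₀ : ℝ) (w₀ : ℝ → ℝ) : ℝ :=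
  β * w₀ r₀

/-- `-a sin(ϑ_β - β ln(lam r₀/2)) + b cos(ϑ_β - β ln(lam r₀/2))`, the left-hand side of the
unperturbed equation. -/
def leadingPart (β r₀ : ℝ) (w₀ : ℝ → ℝ) (lam : ℝ) : ℝ :=
  -coeffA r₀ w₀ * Real.sin (gammaPhase β - β * Real.log (lam * r₀ / 2)) +
    coeffB β r₀ w₀ * Real.cos (gammaPhase β - β * Real.log (lam * r₀ / 2))

/-- The remainder `F_{r₀}`. The determinant divided by the amplitude `√(π / (β sinh(πβ)))` of
`K_{iβ}` at the origin equals `F_{r₀}(lam)` minus the leading part, so that the determinant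
vanishes exactly when the leading part equals `F_{r₀}(lam)`. Here `w lam` is the inner solution
with parameter `lam`. -/
def remainderF (β r₀ : ℝ) (w : ℝ → ℝ → ℝ) (lam : ℝ) : ℝ :=
  leadingPart β r₀ (w 0) lam +
    matchingDet β r₀ lam (w lam) / Real.sqrt (Real.pi / (β * Real.sinh (Real.pi * β)))

/-- The angle `α ∈ (-π, π]` with `cos α = a/√(a² + b²)` and `sin α = b/√(a² + b²)`; it is
`arctan (b/a)` when `a > 0`. -/
def alphaAngle (β r₀ : ℝ) (w₀ : ℝ → ℝ) : ℝ :=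
  (⟨coeffA r₀ w₀, coeffB β r₀ w₀⟩ : ℂ).arg

/-- `lam_n⁰ = (2/r₀) e^{(ϑ_β - α)/β} e^{-nπ/β}`. -/
def lamZero (β r₀ : ℝ) (w₀ : ℝ → ℝ) (n : ℤ) : ℝ :=
  2 / r₀ * Real.exp ((gammaPhase β - alphaAngle β r₀ w₀) / β) * Real.exp (-(n * (Real.pi / β)))

/-- `η ∈ (-π/2, π/2)` solves `sin η = (-1)^n F_{r₀}(lam_n⁰ e^{η/β}) / √(a² + b²)`. -/
def IsPerturbedSolution (β r₀ : ℝ) (w : ℝ → ℝ → ℝ) (n : ℤ) (η : ℝ) : Prop :=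
  η ∈ Ioo (-(Real.pi / 2)) (Real.pi / 2) ∧
    Real.sin η = (-1) ^ n / Real.sqrt (coeffA r₀ (w 0) ^ 2 + coeffB β r₀ (w 0) ^ 2) *
      remainderF β r₀ w (lamZero β r₀ (w 0) n * Real.exp (η / β))

end Efimov

end

noncomputable section

namespace Efimov

/-! Since W(e) = 1 and θ(0) = 1, the numerator of 𝓔 is O(r²), so v is bounded on (0, r₀]. Gronwall's
inequality for the pair (w, w') then makes the data at r₀ Lipschitz in lam² for lam in [0, 1], with
constant proportional to |c|. Run backwards from r₀, it bounds |c| by a multiple of |z|, where z = a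
+ ib. So z ≠ 0, and errors relative to |z| are controlled independently of c
(`exists_norm_complexRemainder_sub_le`, `exists_abs_le_norm_complexCoeff`).

The Bessel side is an exact formula, `macdonald_eq`: K_{iβ}(x) = -A Im(e^{-iφ(x)} g(x²/4)), with
phase φ(x) = ϑ_β - β ln(x/2), amplitude A, and g entire with g(0) = 1. Hence, with φ taken at lam
r₀, L = Im(e^{-iφ} z) and F = -Im(e^{-iφ} R), where R vanishes at lam = 0 and is Lipschitz in lam².

Writing φ = α + nπ - η turns L into (-1)^n |z| sin η, and the equation becomes sin η = G(η) with
both G and its Lipschitz constant O((lam_n⁰)²). Once these are small, `exists_unique_sin_eq` gives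
exactly one root, close to 0. -/

/-! ### Lambert function and boundedness of the potential -/

theorem lambertW_mul_exp {x : ℝ} (hx : 0 < x) : lambertW x * Real.exp (lambertW x) = x := by
  have hex : ∃ s ∈ Ici (-1 : ℝ), (fun s : ℝ => s * Real.exp s) s = x := by
    have hcont : ContinuousOn (fun s : ℝ => s * Real.exp s) (Icc 0 x) := by fun_prop
    obtain ⟨s, hs, hsx⟩ := intermediate_value_Icc hx.le hcont
      (show x ∈ Icc _ _ from ⟨by simpa using hx.le,
        le_mul_of_one_le_right hx.le (Real.one_le_exp hx.le)⟩)
    exact ⟨s, by simp only [mem_Ici]; linarith [hs.1], hsx⟩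
  exact Function.invFunOn_eq hex

/-- With s = W(e^x), taking logarithms gives x - s = log s, which has the same sign as s - 1. Thus x
- 1 is the sum of log s and s - 1, two terms of equal sign. -/
theorem abs_lambertW_exp_sub_le (x : ℝ) : |lambertW (Real.exp x) - x| ≤ |x - 1| := by
  have h := lambertW_mul_exp (Real.exp_pos x)
  set s := lambertW (Real.exp x)
  have hs : 0 < s := by
    by_contra hs
    have := Real.exp_pos x
    have := mul_nonpos_of_nonpos_of_nonneg (not_lt.1 hs) (Real.exp_pos s).le
    linarith
  have hlog : Real.log s + s = x := by
    rw [← Real.log_exp x, ← h, Real.log_mul hs.ne' (Real.exp_pos s).ne', Real.log_exp]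
  rcases le_total 1 s with h1 | h1
  · have := Real.log_nonneg h1
    rw [abs_le]
    constructor <;> cases abs_cases (x - 1) <;> linarith
  · have := Real.log_nonpos hs.le h1
    rw [abs_le]
    constructor <;> cases abs_cases (x - 1) <;> linarith

theorem exists_abs_mul_effectiveEnergy_le {μ ν r₀ : ℝ} (hν : 0 < ν)
    {θ : ℝ → ℝ} (hθ : ContDiffOn ℝ ∞ θ (Ici 0)) (hθ₀ : θ 0 = 1) :
    ∃ V : ℝ, ∀ r ∈ Ioc 0 r₀, |μ * effectiveEnergy ν θ r| ≤ V := by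
  have h1 : ContDiffOn ℝ 1 θ (Icc 0 r₀) :=
    (hθ.of_le (by simp)).mono Icc_subset_Ici_self
  obtain ⟨C, hC⟩ := h1.exists_lipschitzOnWith (by simp) (convex_Icc 0 r₀) isCompact_Icc
  refine ⟨|μ| * (C ^ 2 / ν), fun r hr => ?_⟩
  have hlip := hC.dist_le_mul r ⟨hr.1.le, hr.2⟩ 0 ⟨le_rfl, hr.1.le.trans hr.2⟩
  rw [Real.dist_eq, Real.dist_eq, hθ₀, sub_zero, abs_of_pos hr.1] at hlip
  have h2 : |lambertW (Real.exp (θ r)) - θ r| ≤ C * r := (abs_lambertW_exp_sub_le _).trans hlip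
  rw [abs_mul]
  refine mul_le_mul_of_nonneg_left ?_ (abs_nonneg _)
  have hr0 := hr.1
  unfold effectiveEnergy
  rw [abs_neg, abs_of_nonneg (by positivity), div_le_div_iff₀ (by positivity) hν, ← sq_abs]
  calc _ ≤ (C * r) ^ 2 * ν := by gcongr
    _ = _ := by ring

/-! ### Gronwall estimates for the inner solutions -/

/-- The sup norm on the pair is used: K ≥ 1 absorbs the component y' = z, so only q needs a
hypothesis. -/
theorem norm_pair_le_gronwallBound {R K ε δ : ℝ} {y z q : ℝ → ℝ} (hK : 1 ≤ K) (hε : 0 ≤ ε)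
    (hy : ∀ t ∈ Icc 0 R, HasDerivWithinAt y (z t) (Icc 0 R) t)
    (hz : ∀ t ∈ Icc 0 R, HasDerivWithinAt z (q t) (Icc 0 R) t)
    (hq : ∀ t ∈ Icc 0 R, |q t| ≤ K * |y t| + ε) (hδ : ‖(y 0, z 0)‖ ≤ δ) :
    ∀ t ∈ Icc 0 R, ‖(y t, z t)‖ ≤ gronwallBound δ K ε t := by
  intro t ht
  have h := norm_le_gronwallBound_of_norm_deriv_right_le (f := fun t => (y t, z t))
    (f' := fun t => (z t, q t)) (δ := δ) (K := K) (ε := ε) (a := 0) (b := R)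
    (fun s hs => (hy s hs).continuousWithinAt.prodMk (hz s hs).continuousWithinAt)
    (fun s hs => by
      have hs' := Ico_subset_Icc_self hs
      have := (hy s hs').prodMk (hz s hs')
      exact this.mono_of_mem_nhdsWithin (Icc_mem_nhdsGE_of_mem hs))
    hδ (fun s hs => by
      have hs' := Ico_subset_Icc_self hs
      rw [Prod.norm_def, Prod.norm_def]
      simp only [Real.norm_eq_abs]
      have h1 := hq s hs'
      have h2 := le_max_left |y s| |z s|
      have h3 := le_max_right |y s| |z s|
      have h4 := abs_nonneg (z s)
      refine max_le ?_ ?_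
      · nlinarith
      · nlinarith) t ht
  simpa using h

/-- Time reversal: (y(R - t), -z(R - t)) satisfies a system of the same form. -/
theorem norm_pair_zero_le_of_terminal {R K : ℝ} {y z q : ℝ → ℝ} (hR : 0 ≤ R) (hK : 1 ≤ K)
    (hy : ∀ t ∈ Icc 0 R, HasDerivWithinAt y (z t) (Icc 0 R) t)
    (hz : ∀ t ∈ Icc 0 R, HasDerivWithinAt z (q t) (Icc 0 R) t)
    (hq : ∀ t ∈ Icc 0 R, |q t| ≤ K * |y t|) :
    ‖(y 0, z 0)‖ ≤ ‖(y R, z R)‖ * Real.exp (K * R) := by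
  have hmaps : MapsTo (fun t => R - t) (Icc 0 R) (Icc 0 R) := fun t ht =>
    ⟨by linarith [ht.2], by linarith [ht.1]⟩
  have hlin : ∀ t, HasDerivWithinAt (fun t : ℝ => R - t) (-1) (Icc 0 R) t := fun t => by
    simpa using (hasDerivWithinAt_id t (Icc 0 R)).const_sub R
  have h := norm_pair_le_gronwallBound (R := R) (K := K) (ε := 0)
    (y := fun t => y (R - t)) (z := fun t => -z (R - t)) (q := fun t => q (R - t)) hK le_rfl
    (fun t ht => by
      simpa [Function.comp_def] using HasDerivWithinAt.comp t (hy _ (hmaps ht)) (hlin t) hmaps)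
    (fun t ht => by
      simpa [Function.comp_def, Pi.neg_def] using
        (HasDerivWithinAt.comp t (hz _ (hmaps ht)) (hlin t) hmaps).neg)
    (fun t ht => by simpa using hq _ (hmaps ht)) le_rfl R ⟨hR, le_rfl⟩
  simpa [gronwallBound_ε0, Prod.norm_def] using h

namespace IsInnerSolution

variable {v : ℝ → ℝ} {r₀ c lam : ℝ} {w : ℝ → ℝ}

theorem hasDerivWithinAt (h : IsInnerSolution v r₀ c lam w) {r : ℝ} (hr : r ∈ Icc 0 r₀) :
    HasDerivWithinAt w (derivWithin w (Icc 0 r₀) r) (Icc 0 r₀) r :=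
  (h.contDiffOn.differentiableOn (by simp) r hr).hasDerivWithinAt

theorem contDiffOn_derivWithin (hr₀ : 0 < r₀) (h : IsInnerSolution v r₀ c lam w) :
    ContDiffOn ℝ 1 (derivWithin w (Icc 0 r₀)) (Icc 0 r₀) :=
  h.contDiffOn.derivWithin (uniqueDiffOn_Icc hr₀) (by norm_num)

/-- The equation is assumed only for r > 0. At r = 0 the right side is 0 whatever `v 0` is, because
w(0) = 0; the left side is 0 because w'' is continuous and bounded by (V + lam²)|w| for r > 0. -/
theorem hasDerivWithinAt_derivWithin (hr₀ : 0 < r₀) {V : ℝ} (hV : ∀ r ∈ Ioc 0 r₀, |v r| ≤ V)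
    (h : IsInnerSolution v r₀ c lam w) {r : ℝ} (hr : r ∈ Icc 0 r₀) :
    HasDerivWithinAt (derivWithin w (Icc 0 r₀)) ((v r + lam ^ 2) * w r) (Icc 0 r₀) r := by
  have hd : HasDerivWithinAt (derivWithin w (Icc 0 r₀))
      (derivWithin (derivWithin w (Icc 0 r₀)) (Icc 0 r₀) r) (Icc 0 r₀) r :=
    ((h.contDiffOn_derivWithin hr₀).differentiableOn (by simp) r hr).hasDerivWithinAt
  convert hd using 1
  rcases hr.1.eq_or_lt with h0 | h0
  · subst h0
    rw [h.map_zero, mul_zero]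
    set q := derivWithin (derivWithin w (Icc 0 r₀)) (Icc 0 r₀)
    have hq : ContinuousOn q (Icc 0 r₀) :=
      (h.contDiffOn_derivWithin hr₀).continuousOn_derivWithin (uniqueDiffOn_Icc hr₀) le_rfl
    have hlim1 : Tendsto (fun r => |q r|) (𝓝[Ioc 0 r₀] 0) (𝓝 |q 0|) :=
      ((hq 0 hr).mono Ioc_subset_Icc_self).abs
    have hlim2 : Tendsto (fun r => (V + lam ^ 2) * |w r|) (𝓝[Ioc 0 r₀] 0) (𝓝 0) := by
      have hw := ((h.contDiffOn.continuousOn 0 hr).mono Ioc_subset_Icc_self).tendsto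
      simpa [h.map_zero] using hw.abs.const_mul (V + lam ^ 2)
    have hne : (𝓝[Ioc 0 r₀] (0 : ℝ)).NeBot := by
      rw [nhdsWithin_Ioc_eq_nhdsGT hr₀]; infer_instance
    have hle : |q 0| ≤ 0 := by
      refine le_of_tendsto_of_tendsto hlim1 hlim2 ?_
      filter_upwards [self_mem_nhdsWithin] with r hr
      rw [show q r = _ from sub_eq_zero.1 (h.equation r hr), abs_mul]
      refine mul_le_mul_of_nonneg_right ?_ (abs_nonneg _)
      calc _ ≤ |v r| + |lam ^ 2| := abs_add_le _ _
        _ ≤ _ := by rw [abs_of_nonneg (sq_nonneg lam)]; linarith [hV r hr]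
    exact (abs_nonpos_iff.1 hle).symm
  · exact (sub_eq_zero.1 (h.equation r ⟨h0, hr.2⟩)).symm

theorem abs_coeff_mul_le {V : ℝ} (hV : ∀ r ∈ Ioc 0 r₀, |v r| ≤ V)
    (hlam : lam ∈ Icc (0 : ℝ) 1) {y : ℝ → ℝ} (hy : y 0 = 0) {r : ℝ} (hr : r ∈ Icc 0 r₀) :
    |(v r + lam ^ 2) * y r| ≤ (|V| + 1) * |y r| := by
  rcases hr.1.eq_or_lt with h0 | h0
  · simp [← h0, hy]
  · rw [abs_mul]
    refine mul_le_mul_of_nonneg_right ?_ (abs_nonneg _)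
    have h1 : lam ^ 2 ≤ 1 := pow_le_one₀ hlam.1 hlam.2
    calc _ ≤ |v r| + |lam ^ 2| := abs_add_le _ _
      _ ≤ _ := by
        rw [abs_of_nonneg (sq_nonneg lam)]
        linarith [hV r ⟨h0, hr.2⟩, le_abs_self V]

theorem norm_le (hr₀ : 0 < r₀) {V : ℝ} (hV : ∀ r ∈ Ioc 0 r₀, |v r| ≤ V)
    (hlam : lam ∈ Icc (0 : ℝ) 1) (h : IsInnerSolution v r₀ c lam w) {r : ℝ} (hr : r ∈ Icc 0 r₀) :
    ‖(w r, derivWithin w (Icc 0 r₀) r)‖ ≤ |c| * Real.exp ((|V| + 1) * r₀) := by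
  have hb := norm_pair_le_gronwallBound (K := |V| + 1) (ε := 0) (δ := |c|)
    (by linarith [abs_nonneg V]) le_rfl
    (fun t ht => h.hasDerivWithinAt ht)
    (fun t ht => h.hasDerivWithinAt_derivWithin hr₀ hV ht)
    (fun t ht => by rw [add_zero]; exact abs_coeff_mul_le hV hlam h.map_zero ht)
    (by simp [h.map_zero, h.deriv_zero]) r hr
  rw [gronwallBound_ε0] at hb
  refine hb.trans ?_
  have := hr.2
  gcongr

theorem abs_le_norm_terminal (hr₀ : 0 < r₀) {V : ℝ} (hV : ∀ r ∈ Ioc 0 r₀, |v r| ≤ V)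
    (hlam : lam ∈ Icc (0 : ℝ) 1) (h : IsInnerSolution v r₀ c lam w) :
    |c| ≤ ‖(w r₀, derivWithin w (Icc 0 r₀) r₀)‖ * Real.exp ((|V| + 1) * r₀) := by
  have hb := norm_pair_zero_le_of_terminal (K := |V| + 1) hr₀.le
    (by linarith [abs_nonneg V])
    (fun t ht => h.hasDerivWithinAt ht)
    (fun t ht => h.hasDerivWithinAt_derivWithin hr₀ hV ht)
    (fun t ht => abs_coeff_mul_le hV hlam h.map_zero ht)
  simpa [h.map_zero, h.deriv_zero, Prod.norm_def] using hb

/-- The difference has zero initial data and solves the same equation with forcing term (lam² -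
kap²) u, where u is already bounded by `norm_le`. -/
theorem norm_sub_le (hr₀ : 0 < r₀) {V : ℝ} (hV : ∀ r ∈ Ioc 0 r₀, |v r| ≤ V)
    (hlam : lam ∈ Icc (0 : ℝ) 1) (h : IsInnerSolution v r₀ c lam w)
    {kap : ℝ} (hkap : kap ∈ Icc (0 : ℝ) 1) {u : ℝ → ℝ} (hu : IsInnerSolution v r₀ c kap u) :
    ‖(w r₀ - u r₀, derivWithin w (Icc 0 r₀) r₀ - derivWithin u (Icc 0 r₀) r₀)‖ ≤
      |lam ^ 2 - kap ^ 2| * |c| * Real.exp ((|V| + 1) * r₀) ^ 2 := by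
  have hV0 := abs_nonneg V
  have hb := norm_pair_le_gronwallBound (K := |V| + 1)
    (ε := |lam ^ 2 - kap ^ 2| * (|c| * Real.exp ((|V| + 1) * r₀))) (δ := 0)
    (by linarith) (by positivity)
    (fun t ht => (h.hasDerivWithinAt ht).sub (hu.hasDerivWithinAt ht))
    (fun t ht => (h.hasDerivWithinAt_derivWithin hr₀ hV ht).sub
      (hu.hasDerivWithinAt_derivWithin hr₀ hV ht))
    (fun t ht => by
      have h1 := abs_coeff_mul_le (y := w - u) hV hlam (by simp [h.map_zero, hu.map_zero]) ht
      have h2 : |u t| ≤ |c| * Real.exp ((|V| + 1) * r₀) :=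
        (le_max_left _ _).trans (hu.norm_le hr₀ hV hkap ht)
      have h3 : (v t + lam ^ 2) * w t - (v t + kap ^ 2) * u t =
          (v t + lam ^ 2) * (w - u) t + (lam ^ 2 - kap ^ 2) * u t := by
        simp only [Pi.sub_apply]; ring
      rw [h3]
      refine (abs_add_le _ _).trans (add_le_add h1 ?_)
      rw [abs_mul]
      exact mul_le_mul_of_nonneg_left h2 (abs_nonneg _))
    (by simp [h.map_zero, hu.map_zero, h.deriv_zero, hu.deriv_zero]) r₀ ⟨hr₀.le, le_rfl⟩
  rw [gronwallBound_of_K_ne_0 (by linarith)] at hb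
  refine hb.trans ?_
  simp only [zero_mul, zero_add]
  set E := Real.exp ((|V| + 1) * r₀)
  have hE : 0 < E := Real.exp_pos _
  have h4 : |lam ^ 2 - kap ^ 2| * (|c| * E) / (|V| + 1) ≤ |lam ^ 2 - kap ^ 2| * (|c| * E) :=
    div_le_self (by positivity) (by linarith)
  calc _ ≤ |lam ^ 2 - kap ^ 2| * (|c| * E) / (|V| + 1) * E := by gcongr; linarith
    _ ≤ |lam ^ 2 - kap ^ 2| * (|c| * E) * E := by gcongr
    _ = _ := by ring

end IsInnerSolution

/-! ### Exact form of the Macdonald function -/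

/-- The entire function `Γ(1 + iβ) ∑ₖ z^k / (k! Γ(iβ + k + 1))`, normalized to be `1` at the
origin: the power series factor of `I_{iβ}`. -/
def besselFactor (β : ℝ) (z : ℂ) : ℂ :=
  Complex.Gamma (1 + β * Complex.I) *
    ∑' k : ℕ, z ^ k / ((k.factorial : ℂ) * Complex.Gamma (β * Complex.I + k + 1))

theorem Gamma_one_add_mul_I_ne_zero (β : ℝ) : Complex.Gamma (1 + β * Complex.I) ≠ 0 :=
  Complex.Gamma_ne_zero_of_re_pos (by simp)

/-- Each step of Γ(s + 1) = s Γ(s) multiplies by a factor of real part at least 1. This lets the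
exponential series dominate the one in `besselFactor`. -/
theorem norm_Gamma_one_add_mul_I_le (β : ℝ) (k : ℕ) :
    ‖Complex.Gamma (1 + β * Complex.I)‖ ≤ ‖Complex.Gamma (β * Complex.I + k + 1)‖ := by
  induction k with
  | zero => simp [add_comm]
  | succ k ih =>
    have hre : (β * Complex.I + k + 1 : ℂ).re = k + 1 := by simp
    have hne : (β * Complex.I + k + 1 : ℂ) ≠ 0 := fun h => by
      rw [h] at hre
      simp only [Complex.zero_re] at hre
      linarith [(k.cast_nonneg : (0 : ℝ) ≤ k)]
    have h1 : 1 ≤ ‖(β * Complex.I + k + 1 : ℂ)‖ := by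
      refine le_trans ?_ (Complex.abs_re_le_norm _)
      rw [hre, abs_of_nonneg (by positivity)]
      linarith [(k.cast_nonneg : (0 : ℝ) ≤ k)]
    have h2 : (β * Complex.I + (k + 1 : ℕ) + 1 : ℂ) = (β * Complex.I + k + 1) + 1 := by
      push_cast; ring
    rw [h2, Complex.Gamma_add_one _ hne, norm_mul]
    exact ih.trans (le_mul_of_one_le_left (norm_nonneg _) h1)

theorem differentiable_besselFactor (β : ℝ) : Differentiable ℂ (besselFactor β) := by
  refine Differentiable.const_mul (fun z => ?_) _
  set G := ‖Complex.Gamma (1 + β * Complex.I)‖ with hG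
  have hG0 : 0 < G := norm_pos_iff.2 (Gamma_one_add_mul_I_ne_zero β)
  have hd := Complex.differentiableOn_tsum_of_summable_norm
    (F := fun (k : ℕ) (z : ℂ) =>
      z ^ k / ((k.factorial : ℂ) * Complex.Gamma (β * Complex.I + k + 1)))
    (u := fun k => (‖z‖ + 1) ^ k / k.factorial / G)
    ((Real.summable_pow_div_factorial (‖z‖ + 1)).div_const G)
    (fun k => by fun_prop) (Metric.isOpen_ball (x := (0 : ℂ)) (ε := ‖z‖ + 1))
    (fun k w hw => by
      rw [norm_div, norm_pow, norm_mul, Complex.norm_natCast, div_div]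
      have hw' : ‖w‖ ≤ ‖z‖ + 1 := (mem_ball_zero_iff.1 hw).le
      have := norm_Gamma_one_add_mul_I_le β k
      have hf : (0 : ℝ) < k.factorial := by positivity
      gcongr)
  exact hd.differentiableAt (Metric.isOpen_ball.mem_nhds (by simp))

theorem besselFactor_zero (β : ℝ) : besselFactor β 0 = 1 := by
  unfold besselFactor
  rw [tsum_eq_single 0 (fun k hk => by simp [hk])]
  simpa [add_comm] using mul_inv_cancel₀ (Gamma_one_add_mul_I_ne_zero β)

/-- Reflection formula, since the conjugate of Γ(1 + iβ) is Γ(1 - iβ). -/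
theorem normSq_Gamma_one_add_mul_I {β : ℝ} (hβ : 0 < β) :
    ‖Complex.Gamma (1 + β * Complex.I)‖ ^ 2 = Real.pi * β / Real.sinh (Real.pi * β) := by
  have hne : (β * Complex.I : ℂ) ≠ 0 := by simp [hβ.ne']
  have hsinh : Real.sinh (Real.pi * β) ≠ 0 :=
    (Real.sinh_pos_iff.2 (mul_pos Real.pi_pos hβ)).ne'
  have h1 := Complex.Gamma_mul_Gamma_one_sub (β * Complex.I)
  have h2 : (starRingEnd ℂ) (Complex.Gamma (1 + β * Complex.I)) =
      Complex.Gamma (1 - β * Complex.I) := by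
    rw [← Complex.Gamma_conj]; congr 1; simp [sub_eq_add_neg]
  have h3 : Complex.Gamma (1 + β * Complex.I) = β * Complex.I * Complex.Gamma (β * Complex.I) := by
    rw [add_comm, Complex.Gamma_add_one _ hne]
  have h4 : Complex.sin (Real.pi * (β * Complex.I)) =
      (Real.sinh (Real.pi * β) : ℂ) * Complex.I := by
    rw [← mul_assoc, Complex.sin_mul_I, ← Complex.ofReal_mul, Complex.ofReal_sinh]
  have h5 := Complex.mul_conj (Complex.Gamma (1 + β * Complex.I))
  rw [h2, h3, mul_assoc, h1, h4, ← h3, Complex.normSq_eq_norm_sq] at h5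
  have hs' : (Real.sinh (Real.pi * β) : ℂ) ≠ 0 := Complex.ofReal_ne_zero.2 hsinh
  have h6 : (((Real.pi * β / Real.sinh (Real.pi * β) : ℝ)) : ℂ) =
      ((‖Complex.Gamma (1 + β * Complex.I)‖ ^ 2 : ℝ) : ℂ) := by
    rw [← h5, Complex.ofReal_div, Complex.ofReal_mul]
    field_simp [Complex.I_ne_zero]
  exact (Complex.ofReal_injective h6).symm

/-- The amplitude `√(π / (β sinh(πβ)))` of `K_{iβ}` at the origin. -/
def amplitude (β : ℝ) : ℝ := Real.sqrt (Real.pi / (β * Real.sinh (Real.pi * β)))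

theorem amplitude_pos {β : ℝ} (hβ : 0 < β) : 0 < amplitude β :=
  Real.sqrt_pos.2 (div_pos Real.pi_pos (mul_pos hβ
    (Real.sinh_pos_iff.2 (mul_pos Real.pi_pos hβ))))

theorem amplitude_mul_norm_Gamma {β : ℝ} (hβ : 0 < β) :
    amplitude β * ‖Complex.Gamma (1 + β * Complex.I)‖ = Real.pi / Real.sinh (Real.pi * β) := by
  have hsinh : 0 < Real.sinh (Real.pi * β) := Real.sinh_pos_iff.2 (mul_pos Real.pi_pos hβ)
  have hpi := Real.pi_pos
  refine (sq_eq_sq₀ (mul_nonneg (amplitude_pos hβ).le (norm_nonneg _)) (by positivity)).1 ?_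
  rw [mul_pow, normSq_Gamma_one_add_mul_I hβ, amplitude, Real.sq_sqrt (by positivity)]
  field_simp

/-- The phase `ϑ_β - β ln(x/2)` of `K_{iβ}(x)` near the origin. -/
def besselPhase (β x : ℝ) : ℝ := gammaPhase β - β * Real.log (x / 2)

/-- Polar form of Γ(1 + iβ): its argument ϑ_β combines with (x/2)^{iβ} = e^{iβ ln(x/2)} into the
single phase. -/
theorem besselI_mul_I_eq (β : ℝ) {x : ℝ} (hx : 0 < x) :
    besselI (β * Complex.I) x = Complex.exp (-(besselPhase β x * Complex.I)) *
      besselFactor β ((x ^ 2 / 4 : ℝ) : ℂ) / ‖Complex.Gamma (1 + β * Complex.I)‖ := by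
  have hpow : ((x : ℂ) / 2) ^ (β * Complex.I) =
      Complex.exp ((β * Real.log (x / 2) : ℝ) * Complex.I) := by
    have h2 : ((x : ℂ) / 2) = ((x / 2 : ℝ) : ℂ) := by push_cast; rfl
    rw [h2, Complex.cpow_def_of_ne_zero (by exact_mod_cast (half_pos hx).ne'),
      ← Complex.ofReal_log (half_pos hx).le]
    congr 1; push_cast; ring
  have hG := Complex.norm_mul_exp_arg_mul_I (Complex.Gamma (1 + β * Complex.I))
  have hn : (‖Complex.Gamma (1 + β * Complex.I)‖ : ℂ) ≠ 0 := by
    simpa using Gamma_one_add_mul_I_ne_zero β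
  unfold besselI besselFactor
  rw [hpow]
  have hphase : Complex.exp (-(besselPhase β x * Complex.I)) *
      Complex.exp ((Complex.Gamma (1 + β * Complex.I)).arg * Complex.I) =
      Complex.exp ((β * Real.log (x / 2) : ℝ) * Complex.I) := by
    rw [← Complex.exp_add]; congr 1
    unfold besselPhase gammaPhase; push_cast; ring
  rw [← hphase, eq_div_iff hn]
  nth_rewrite 3 [← hG]
  push_cast
  ring

/-- I_{-iβ}(x) is the conjugate of I_{iβ}(x), so their difference is an imaginary part, and sin(iπβ)
= i sinh(πβ). -/
theorem macdonald_eq {β : ℝ} (hβ : 0 < β) {x : ℝ} (hx : 0 < x) :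
    macdonald β x = amplitude β * (-(Complex.exp (-(besselPhase β x * Complex.I)) *
      besselFactor β ((x ^ 2 / 4 : ℝ) : ℂ)).im) := by
  have hsinh : Real.sinh (Real.pi * β) ≠ 0 :=
    (Real.sinh_pos_iff.2 (mul_pos Real.pi_pos hβ)).ne'
  have hs' : (Real.sinh (Real.pi * β) : ℂ) ≠ 0 := Complex.ofReal_ne_zero.2 hsinh
  have hsin : Complex.sin (Real.pi * (β * Complex.I)) =
      (Real.sinh (Real.pi * β) : ℂ) * Complex.I := by
    rw [← mul_assoc, Complex.sin_mul_I, ← Complex.ofReal_mul, Complex.ofReal_sinh]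
  have hconj : besselI (-(β * Complex.I)) x = (starRingEnd ℂ) (besselI (β * Complex.I) x) := by
    rw [conj_besselI _ hx]; simp
  have hK : besselK (β * Complex.I) x =
      ((Real.pi / Real.sinh (Real.pi * β) * -(besselI (β * Complex.I) x).im : ℝ) : ℂ) := by
    unfold besselK
    have h := Complex.sub_conj (besselI (β * Complex.I) x)
    rw [hsin, hconj, ← neg_sub, h]
    push_cast
    field_simp [Complex.I_ne_zero]
  have hn : ‖Complex.Gamma (1 + β * Complex.I)‖ ≠ 0 :=
    norm_ne_zero_iff.2 (Gamma_one_add_mul_I_ne_zero β)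
  rw [macdonald, hK, Complex.ofReal_re, besselI_mul_I_eq β hx, Complex.div_ofReal_im,
    ← amplitude_mul_norm_Gamma hβ]
  field_simp

/-- The operator x d/dx multiplies e^{-iφ} by iβ, and sends g(x²/4) to 2t g'(t) at t = x²/4. -/
theorem mul_deriv_macdonald_eq {β : ℝ} (hβ : 0 < β) {x : ℝ} (hx : 0 < x) :
    x * deriv (macdonald β) x = amplitude β * (-(Complex.exp (-(besselPhase β x * Complex.I)) *
      (β * Complex.I * besselFactor β ((x ^ 2 / 4 : ℝ) : ℂ) +
        2 * ((x ^ 2 / 4 : ℝ) : ℂ) * deriv (besselFactor β) ((x ^ 2 / 4 : ℝ) : ℂ))).im) := by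
  have h1 : HasDerivAt (besselPhase β) (-(β / x)) x := by
    have h := ((((hasDerivAt_id x).div_const 2).log (by simp [hx.ne'])).const_mul β).const_sub
      (gammaPhase β)
    exact h.congr_deriv (by simp only [id]; field_simp)
  have h2 : HasDerivAt (fun y : ℝ => Complex.exp (-(besselPhase β y * Complex.I)))
      (Complex.exp (-(besselPhase β x * Complex.I)) * -(((-(β / x) : ℝ) : ℂ) * Complex.I)) x :=
    ((h1.ofReal_comp.mul_const Complex.I).neg).cexp
  have h3 : HasDerivAt (fun y : ℝ => besselFactor β ((y ^ 2 / 4 : ℝ) : ℂ))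
      (deriv (besselFactor β) ((x ^ 2 / 4 : ℝ) : ℂ) * ((x / 2 : ℝ) : ℂ)) x := by
    have h4 : HasDerivAt (fun y : ℝ => y ^ 2 / 4) (x / 2) x := by
      have h := (hasDerivAt_pow 2 x).div_const 4
      exact h.congr_deriv (by norm_num; ring)
    exact (differentiable_besselFactor β _).hasDerivAt.comp x h4.ofReal_comp
  have h5 := ((Complex.imCLM.hasFDerivAt.comp_hasDerivAt x (h2.mul h3)).neg).const_mul
    (amplitude β)
  have h6 : HasDerivAt (macdonald β) _ x := h5.congr_of_eventuallyEq (by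
    filter_upwards [Ioi_mem_nhds hx] with y hy
    exact macdonald_eq hβ hy)
  rw [h6.deriv, mul_left_comm, mul_neg, Complex.imCLM_apply, ← Complex.im_ofReal_mul]
  congr 3
  have hx' : (x : ℂ) ≠ 0 := by exact_mod_cast hx.ne'
  push_cast
  field_simp
  ring

/-! ### Complex form of the determinant and bounds on the remainder -/

theorem exists_bound_and_lipschitz_of_differentiable {f : ℂ → ℂ} (hf : Differentiable ℂ f) (T : ℝ) :
    ∃ M : ℝ, 0 ≤ M ∧ (∀ t ∈ Icc 0 T, ‖f (t : ℂ)‖ ≤ M) ∧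
      ∀ s ∈ Icc 0 T, ∀ t ∈ Icc 0 T, ‖f (s : ℂ) - f (t : ℂ)‖ ≤ M * |s - t| := by
  have hcd : ContDiff ℝ 1 (fun t : ℝ => f (t : ℂ)) :=
    (hf.contDiff.restrict_scalars ℝ).comp Complex.ofRealCLM.contDiff
  obtain ⟨K, hK⟩ := hcd.contDiffOn.exists_lipschitzOnWith (by simp) (convex_Icc 0 T) isCompact_Icc
  obtain ⟨C, hC⟩ := (isCompact_Icc (a := (0 : ℝ)) (b := T)).exists_bound_of_continuousOn
    hcd.continuous.continuousOn
  refine ⟨max C K, le_max_of_le_right K.2, fun t ht => (hC t ht).trans (le_max_left _ _),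
    fun s hs t ht => ?_⟩
  have h := hK.dist_le_mul s hs t ht
  rw [dist_eq_norm, Real.dist_eq] at h
  exact h.trans (mul_le_mul_of_nonneg_right (le_max_right _ _) (abs_nonneg _))

theorem norm_mul_sub_mul_le {x y p q : ℂ} {X P dX dP : ℝ} (hy : ‖y‖ ≤ X) (hp : ‖p‖ ≤ P)
    (hxy : ‖x - y‖ ≤ dX) (hpq : ‖p - q‖ ≤ dP) : ‖x * p - y * q‖ ≤ dX * P + X * dP := by
  have h : x * p - y * q = (x - y) * p + y * (p - q) := by ring
  rw [h]
  refine (norm_add_le _ _).trans (add_le_add ?_ ?_) <;> rw [norm_mul]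
  · exact mul_le_mul hxy hp (norm_nonneg _) ((norm_nonneg _).trans hxy)
  · exact mul_le_mul hy hpq (norm_nonneg _) ((norm_nonneg _).trans hy)

/-- The complex number `a + iβ w(r₀)` attached to an inner solution. -/
def complexCoeff (β r₀ : ℝ) (w : ℝ → ℝ) : ℂ := coeffA r₀ w + coeffB β r₀ w * Complex.I

/-- The complex remainder whose rotation by `besselPhase` gives `remainderF`. -/
def complexRemainder (β r₀ : ℝ) (w : ℝ → ℝ → ℝ) (lam : ℝ) : ℂ :=
  complexCoeff β r₀ (w lam) * besselFactor β (((lam * r₀) ^ 2 / 4 : ℝ) : ℂ) +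
    w lam r₀ * (2 * (((lam * r₀) ^ 2 / 4 : ℝ) : ℂ) *
      deriv (besselFactor β) (((lam * r₀) ^ 2 / 4 : ℝ) : ℂ)) -
    complexCoeff β r₀ (w 0)

theorem complexRemainder_zero (β r₀ : ℝ) (w : ℝ → ℝ → ℝ) : complexRemainder β r₀ w 0 = 0 := by
  simp [complexRemainder, besselFactor_zero]

theorem leadingPart_eq_im (β r₀ : ℝ) (w₀ : ℝ → ℝ) (lam : ℝ) :
    leadingPart β r₀ w₀ lam =
      (Complex.exp (-(besselPhase β (lam * r₀) * Complex.I)) * complexCoeff β r₀ w₀).im := by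
  rw [← neg_mul, ← Complex.ofReal_neg, Complex.exp_mul_I, ← Complex.ofReal_cos,
    ← Complex.ofReal_sin]
  simp only [leadingPart, complexCoeff, besselPhase, Complex.mul_im, Complex.add_re,
    Complex.add_im, Complex.mul_re, Complex.ofReal_re, Complex.ofReal_im, Complex.I_re,
    Complex.I_im, Real.cos_neg, Real.sin_neg]
  ring

/-- The term iβ w(r₀) coming from x K'(x) is exactly what completes the real coefficient of K to
`complexCoeff`. -/
theorem matchingDet_div_amplitude {β r₀ lam : ℝ} (hβ : 0 < β) (hr₀ : 0 < r₀) (hlam : 0 < lam)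
    (w : ℝ → ℝ) :
    matchingDet β r₀ lam w / amplitude β =
      -(Complex.exp (-(besselPhase β (lam * r₀) * Complex.I)) *
        (complexCoeff β r₀ w * besselFactor β (((lam * r₀) ^ 2 / 4 : ℝ) : ℂ) +
          w r₀ * (2 * (((lam * r₀) ^ 2 / 4 : ℝ) : ℂ) *
            deriv (besselFactor β) (((lam * r₀) ^ 2 / 4 : ℝ) : ℂ)))).im := by
  have hx := mul_pos hlam hr₀
  have h : matchingDet β r₀ lam w = coeffA r₀ w * macdonald β (lam * r₀) +
      w r₀ * (lam * r₀ * deriv (macdonald β) (lam * r₀)) := by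
    unfold matchingDet coeffA; ring
  rw [h, mul_deriv_macdonald_eq hβ hx, macdonald_eq hβ hx, mul_left_comm, mul_left_comm (w r₀),
    ← mul_add, mul_div_cancel_left₀ _ (amplitude_pos hβ).ne', mul_neg, mul_neg, ← neg_add,
    ← Complex.im_ofReal_mul, ← Complex.im_ofReal_mul, ← Complex.add_im]
  congr 2
  unfold complexCoeff coeffB
  push_cast
  ring

theorem remainderF_eq_im {β r₀ lam : ℝ} (hβ : 0 < β) (hr₀ : 0 < r₀) (hlam : 0 < lam)
    (w : ℝ → ℝ → ℝ) :
    remainderF β r₀ w lam = -(Complex.exp (-(besselPhase β (lam * r₀) * Complex.I)) *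
      complexRemainder β r₀ w lam).im := by
  rw [remainderF, ← amplitude, matchingDet_div_amplitude hβ hr₀ hlam, leadingPart_eq_im,
    complexRemainder, mul_sub, Complex.sub_im]
  ring

theorem norm_complexCoeff_sub_le {β r₀ : ℝ} (hβ : 0 < β) (hr₀ : 0 < r₀) (w u : ℝ → ℝ) {S : ℝ}
    (h : ‖(w r₀ - u r₀, derivWithin w (Icc 0 r₀) r₀ - derivWithin u (Icc 0 r₀) r₀)‖ ≤ S) :
    ‖complexCoeff β r₀ w - complexCoeff β r₀ u‖ ≤ (1 + r₀ + β) * S := by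
  rw [Prod.norm_def, max_le_iff] at h
  obtain ⟨h1, h2⟩ := h
  have he : complexCoeff β r₀ w - complexCoeff β r₀ u =
      (1 / 2 + β * Complex.I) * ((w r₀ - u r₀ : ℝ) : ℂ) -
        r₀ * ((derivWithin w (Icc 0 r₀) r₀ - derivWithin u (Icc 0 r₀) r₀ : ℝ) : ℂ) := by
    unfold complexCoeff coeffA coeffB
    push_cast
    ring
  have h3 : ‖(1 / 2 + β * Complex.I : ℂ)‖ ≤ 1 + β := by
    refine (norm_add_le _ _).trans ?_
    simp [abs_of_pos hβ]
    norm_num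
  rw [he]
  refine (norm_sub_le _ _).trans ?_
  rw [norm_mul, norm_mul, Complex.norm_real, Complex.norm_real, Complex.norm_real,
    Real.norm_of_nonneg hr₀.le]
  simp only at h1 h2
  calc _ ≤ (1 + β) * S + r₀ * S := by gcongr
    _ = _ := by ring

/-- Each factor is bounded and Lipschitz in lam²: the inner data by Gronwall, the Bessel factors by
compactness. The constant is fixed before c and w. -/
theorem exists_norm_complexRemainder_sub_le {β r₀ V : ℝ} (hβ : 0 < β) (hr₀ : 0 < r₀) {v : ℝ → ℝ}
    (hV : ∀ r ∈ Ioc 0 r₀, |v r| ≤ V) :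
    ∃ C : ℝ, 0 ≤ C ∧ ∀ (c : ℝ) (w : ℝ → ℝ → ℝ),
      (∀ lam : ℝ, 0 ≤ lam → IsInnerSolution v r₀ c lam (w lam)) →
      ∀ lam ∈ Icc (0 : ℝ) 1, ∀ kap ∈ Icc (0 : ℝ) 1,
        ‖complexRemainder β r₀ w lam - complexRemainder β r₀ w kap‖ ≤
          C * |c| * |lam ^ 2 - kap ^ 2| := by
  have hg := differentiable_besselFactor β
  obtain ⟨M, hM0, hM, hM'⟩ := exists_bound_and_lipschitz_of_differentiable hg (r₀ ^ 2 / 4)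
  obtain ⟨N, hN0, hN, hN'⟩ := exists_bound_and_lipschitz_of_differentiable
    (f := fun z => 2 * z * deriv (besselFactor β) z)
    ((differentiable_id.const_mul 2).mul hg.contDiff.differentiable_deriv_two) (r₀ ^ 2 / 4)
  set E := Real.exp ((|V| + 1) * r₀) with hE
  have hE0 : 0 < E := Real.exp_pos _
  refine ⟨(1 + r₀ + β) * E ^ 2 * M + (1 + r₀ + β) * E * (M * (r₀ ^ 2 / 4)) +
    (E ^ 2 * N + E * (N * (r₀ ^ 2 / 4))), by positivity, fun c w hw lam hlam kap hkap => ?_⟩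
  have ht : ∀ l ∈ Icc (0 : ℝ) 1, (l * r₀) ^ 2 / 4 ∈ Icc 0 (r₀ ^ 2 / 4) := fun l hl => by
    refine ⟨by positivity, ?_⟩
    rw [mul_pow]
    have h1 : l ^ 2 ≤ 1 := pow_le_one₀ hl.1 hl.2
    nlinarith [sq_nonneg r₀]
  have hdt : |(lam * r₀) ^ 2 / 4 - (kap * r₀) ^ 2 / 4| =
      r₀ ^ 2 / 4 * |lam ^ 2 - kap ^ 2| := by
    rw [show (lam * r₀) ^ 2 / 4 - (kap * r₀) ^ 2 / 4 = r₀ ^ 2 / 4 * (lam ^ 2 - kap ^ 2) by ring,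
      abs_mul, abs_of_nonneg (show 0 ≤ r₀ ^ 2 / 4 by positivity)]
  have hsub := (hw lam hlam.1).norm_sub_le hr₀ hV hlam hkap (hw kap hkap.1)
  have hb := (hw kap hkap.1).norm_le hr₀ hV hkap (r := r₀) ⟨hr₀.le, le_rfl⟩
  rw [← hE] at hsub hb
  have hcc := norm_complexCoeff_sub_le hβ hr₀ _ _ hsub
  have hcb : ‖complexCoeff β r₀ (w kap)‖ ≤ (1 + r₀ + β) * (|c| * E) := by
    -- Comparison with u = 0 turns the difference estimate into a bound.
    have h := norm_complexCoeff_sub_le (u := 0) hβ hr₀ (w kap) (by simpa using hb)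
    simpa [complexCoeff, coeffA, coeffB] using h
  have hww : ‖((w lam r₀ : ℝ) : ℂ) - ((w kap r₀ : ℝ) : ℂ)‖ ≤
      |lam ^ 2 - kap ^ 2| * |c| * E ^ 2 := by
    rw [← Complex.ofReal_sub, Complex.norm_real]
    exact (le_max_left _ _).trans hsub
  have hwb : ‖((w kap r₀ : ℝ) : ℂ)‖ ≤ |c| * E := by
    rw [Complex.norm_real]
    exact (le_max_left _ _).trans hb
  have h1 := norm_mul_sub_mul_le hcb (hM _ (ht lam hlam)) hcc
    (hM' _ (ht lam hlam) _ (ht kap hkap))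
  have h2 := norm_mul_sub_mul_le hwb (hN _ (ht lam hlam)) hww
    (hN' _ (ht lam hlam) _ (ht kap hkap))
  rw [hdt] at h1 h2
  rw [complexRemainder, complexRemainder, sub_sub_sub_cancel_right, add_sub_add_comm]
  refine (norm_add_le _ _).trans ((add_le_add h1 h2).trans (le_of_eq ?_))
  ring

/-- The real and imaginary parts a and βw(r₀) determine w(r₀) and w'(r₀), from which backward
Gronwall recovers c. -/
theorem exists_abs_le_norm_complexCoeff {β r₀ V : ℝ} (hβ : 0 < β) (hr₀ : 0 < r₀) {v : ℝ → ℝ}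
    (hV : ∀ r ∈ Ioc 0 r₀, |v r| ≤ V) :
    ∃ C : ℝ, 0 ≤ C ∧ ∀ (c : ℝ) (w : ℝ → ℝ), IsInnerSolution v r₀ c 0 w →
      |c| ≤ C * ‖complexCoeff β r₀ w‖ := by
  set E := Real.exp ((|V| + 1) * r₀) with hE
  have hE0 : 0 < E := Real.exp_pos _
  refine ⟨(1 / β + (1 + 1 / β) / r₀) * E, by positivity, fun c w hw => ?_⟩
  have h := hw.abs_le_norm_terminal hr₀ hV ⟨le_rfl, zero_le_one⟩
  rw [← hE] at h
  set ρ := ‖complexCoeff β r₀ w‖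
  have hρ : 0 ≤ ρ := norm_nonneg _
  have h1 : |coeffA r₀ w| ≤ ρ := by
    simpa [ρ, complexCoeff] using Complex.abs_re_le_norm (complexCoeff β r₀ w)
  have h2 : |w r₀| ≤ 1 / β * ρ := by
    have h3 : |coeffB β r₀ w| ≤ ρ := by
      simpa [ρ, complexCoeff] using Complex.abs_im_le_norm (complexCoeff β r₀ w)
    rw [coeffB, abs_mul, abs_of_pos hβ] at h3
    rw [one_div_mul_eq_div, le_div_iff₀ hβ]
    linarith
  have h4 : |derivWithin w (Icc 0 r₀) r₀| ≤ (1 + 1 / β) / r₀ * ρ := by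
    have h5 : r₀ * derivWithin w (Icc 0 r₀) r₀ = w r₀ / 2 - coeffA r₀ w := by
      unfold coeffA; ring
    have h6 : r₀ * |derivWithin w (Icc 0 r₀) r₀| ≤ |w r₀| + |coeffA r₀ w| := by
      rw [← abs_of_pos hr₀, ← abs_mul, abs_of_pos hr₀, h5]
      refine (abs_sub _ _).trans ?_
      rw [abs_div, abs_two]
      linarith [abs_nonneg (w r₀)]
    rw [div_mul_eq_mul_div, le_div_iff₀ hr₀]
    linarith
  have h7 : ‖(w r₀, derivWithin w (Icc 0 r₀) r₀)‖ ≤ (1 / β + (1 + 1 / β) / r₀) * ρ := by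
    rw [add_mul]
    have : 0 ≤ 1 / β * ρ := by positivity
    have : 0 ≤ (1 + 1 / β) / r₀ * ρ := by positivity
    refine max_le ?_ ?_ <;> simp only [Real.norm_eq_abs] <;> linarith
  calc |c| ≤ _ := h
    _ ≤ (1 / β + (1 + 1 / β) / r₀) * ρ * E := by gcongr
    _ = _ := by ring

/-! ### The scalar equation sin x = G x -/

/-- Write sin x - sin y as 2 sin((x-y)/2) cos((x+y)/2). Jordan's inequality with 2/π ≥ 3/5 and cos ≥
9/10 gives the factor 27/50 > 1/2. -/
theorem mul_abs_sub_le_abs_sin_sub_sin {x y : ℝ} (hx : |x| ≤ Real.pi / 8)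
    (hy : |y| ≤ Real.pi / 8) : |x - y| / 2 ≤ |Real.sin x - Real.sin y| := by
  have hpi := Real.pi_pos
  have hpi3 := Real.pi_lt_d2
  rw [abs_le] at hx hy
  have h1 : 2 / Real.pi * |(x - y) / 2| ≤ |Real.sin ((x - y) / 2)| :=
    Real.mul_abs_le_abs_sin (by rw [abs_le]; constructor <;> linarith)
  have h2 : 9 / 10 ≤ Real.cos ((x + y) / 2) := by
    have h3 := Real.one_sub_sq_div_two_le_cos (x := (x + y) / 2)
    have h4 : ((x + y) / 2) ^ 2 ≤ (Real.pi / 8) ^ 2 :=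
      sq_le_sq' (by linarith) (by linarith)
    nlinarith
  have h5 : 3 / 5 ≤ 2 / Real.pi := by rw [le_div_iff₀ hpi]; linarith
  rw [Real.sin_sub_sin, abs_mul, abs_mul, abs_two, abs_of_nonneg (by linarith : 0 ≤ Real.cos _)]
  rw [abs_div, abs_two] at h1
  have h6 : 3 / 5 * (|x - y| / 2) ≤ |Real.sin ((x - y) / 2)| :=
    (mul_le_mul_of_nonneg_right h5 (by positivity)).trans h1
  have h7 := abs_nonneg (x - y)
  nlinarith

theorem abs_le_of_sin_eq {x s ε : ℝ} (hx : |x| ≤ Real.pi / 2) (h : Real.sin x = s)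
    (hs : |s| ≤ ε) : |x| ≤ Real.pi / 2 * ε := by
  have hpi := Real.pi_pos
  have h1 := Real.mul_abs_le_abs_sin hx
  rw [h, div_mul_eq_mul_div, div_le_iff₀ hpi] at h1
  nlinarith

/-- Existence is the intermediate value theorem, as |G| < 1 at the endpoints. Jordan's inequality
confines every root to |x| ≤ π/8, where sin expands distances by at least 1/2, while G has Lipschitz
constant at most 1/4. -/
theorem exists_unique_sin_eq {G : ℝ → ℝ} {ε : ℝ} (hε : ε ≤ 1 / 4)
    (hG : ∀ x ∈ Icc (-(Real.pi / 2)) (Real.pi / 2), |G x| ≤ ε)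
    (hL : ∀ x ∈ Icc (-(Real.pi / 2)) (Real.pi / 2), ∀ y ∈ Icc (-(Real.pi / 2)) (Real.pi / 2),
      |G x - G y| ≤ ε * |x - y|) :
    ∃ x ∈ Ioo (-(Real.pi / 2)) (Real.pi / 2), Real.sin x = G x ∧ |x| ≤ Real.pi / 2 * ε ∧
      ∀ y ∈ Ioo (-(Real.pi / 2)) (Real.pi / 2), Real.sin y = G y → y = x := by
  have hpi := Real.pi_pos
  have hle : -(Real.pi / 2) ≤ Real.pi / 2 := by linarith
  have hε0 : 0 ≤ ε := (abs_nonneg _).trans (hG _ (left_mem_Icc.2 hle))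
  have hcont : ContinuousOn G (Icc (-(Real.pi / 2)) (Real.pi / 2)) :=
    (LipschitzOnWith.of_dist_le_mul (K := ⟨ε, hε0⟩) fun x hx y hy => hL x hx y hy).continuousOn
  have hsmall : ∀ y ∈ Icc (-(Real.pi / 2)) (Real.pi / 2), Real.sin y = G y →
      |y| ≤ Real.pi / 2 * ε := fun y hy h => abs_le_of_sin_eq (abs_le.2 hy) h (hG y hy)
  have hl := abs_le.1 (hG _ (left_mem_Icc.2 hle))
  have hr := abs_le.1 (hG _ (right_mem_Icc.2 hle))
  obtain ⟨x, hx, hx0⟩ := intermediate_value_Icc hle (Real.continuous_sin.continuousOn.sub hcont)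
    (show (0 : ℝ) ∈ Icc _ _ by
      simp only [Pi.sub_apply, Real.sin_neg, Real.sin_pi_div_two]
      constructor <;> linarith)
  have hsx : Real.sin x = G x := sub_eq_zero.1 hx0
  have hx1 := hsmall x hx hsx
  have hpe : Real.pi / 2 * ε ≤ Real.pi / 8 := by nlinarith
  have hx2 := abs_le.1 (hx1.trans hpe)
  refine ⟨x, ⟨by linarith, by linarith⟩, hsx, hx1, fun y hy hsy => ?_⟩
  have hy' := Ioo_subset_Icc_self hy
  have h1 := mul_abs_sub_le_abs_sin_sub_sin ((hsmall y hy' hsy).trans hpe) (hx1.trans hpe)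
  have h2 := hL y hy' x hx
  rw [hsx, hsy] at h1
  have h3 := abs_nonneg (y - x)
  have h4 : |y - x| ≤ 0 := by nlinarith
  exact sub_eq_zero.1 (abs_nonpos_iff.1 h4)

theorem abs_exp_sub_exp_le {x y m : ℝ} (hx : x ≤ m) (hy : y ≤ m) :
    |Real.exp x - Real.exp y| ≤ Real.exp m * |x - y| := by
  wlog hxy : y ≤ x generalizing x y
  · rw [abs_sub_comm, abs_sub_comm x]
    exact this hy hx (le_of_not_ge hxy)
  rw [abs_of_nonneg (sub_nonneg.2 (Real.exp_le_exp.2 hxy)), abs_of_nonneg (sub_nonneg.2 hxy)]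
  have h1 := Real.add_one_le_exp (y - x)
  have h2 : Real.exp y = Real.exp x * Real.exp (y - x) := by rw [← Real.exp_add]; ring_nf
  have h3 : Real.exp x ≤ Real.exp m := Real.exp_le_exp.2 hx
  have h4 := Real.exp_pos x
  calc Real.exp x - Real.exp y = Real.exp x * (1 - Real.exp (y - x)) := by rw [h2]; ring
    _ ≤ Real.exp x * (x - y) := mul_le_mul_of_nonneg_left (by linarith) h4.le
    _ ≤ Real.exp m * (x - y) := mul_le_mul_of_nonneg_right h3 (sub_nonneg.2 hxy)

/-! ### Parametrisation of the spectral parameter by its phase -/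

theorem sqrt_coeff_eq_norm (β r₀ : ℝ) (w : ℝ → ℝ) :
    Real.sqrt (coeffA r₀ w ^ 2 + coeffB β r₀ w ^ 2) = ‖complexCoeff β r₀ w‖ :=
  (Complex.norm_add_mul_I _ _).symm

theorem alphaAngle_eq_arg (β r₀ : ℝ) (w : ℝ → ℝ) :
    alphaAngle β r₀ w = (complexCoeff β r₀ w).arg := by
  rw [alphaAngle, complexCoeff, Complex.mk_eq_add_mul_I]

theorem leadingPart_eq_norm_mul_sin (β r₀ : ℝ) (w₀ : ℝ → ℝ) (lam : ℝ) :
    leadingPart β r₀ w₀ lam = ‖complexCoeff β r₀ w₀‖ *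
      Real.sin (alphaAngle β r₀ w₀ - besselPhase β (lam * r₀)) := by
  rw [leadingPart_eq_im, alphaAngle_eq_arg]
  nth_rewrite 1 [← Complex.norm_mul_exp_arg_mul_I (complexCoeff β r₀ w₀)]
  rw [mul_left_comm, ← Complex.exp_add, Complex.im_ofReal_mul, ← Complex.exp_ofReal_mul_I_im]
  congr 3
  push_cast
  ring

variable {β r₀ : ℝ}

theorem lamZero_pos (hr₀ : 0 < r₀) (w₀ : ℝ → ℝ) (n : ℤ) : 0 < lamZero β r₀ w₀ n := by
  unfold lamZero; positivity

theorem lamZero_mul_exp_eq (w₀ : ℝ → ℝ) (n : ℤ) (η : ℝ) :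
    lamZero β r₀ w₀ n * Real.exp (η / β) = 2 / r₀ *
      Real.exp ((gammaPhase β - (alphaAngle β r₀ w₀ + n * Real.pi - η)) / β) := by
  rw [lamZero, mul_assoc, mul_assoc, ← Real.exp_add, ← Real.exp_add]
  congr 2
  ring

theorem besselPhase_mul_exp (hβ : 0 < β) (hr₀ : 0 < r₀) (φ : ℝ) :
    besselPhase β (2 / r₀ * Real.exp ((gammaPhase β - φ) / β) * r₀) = φ := by
  rw [besselPhase]
  have h : 2 / r₀ * Real.exp ((gammaPhase β - φ) / β) * r₀ / 2 =
      Real.exp ((gammaPhase β - φ) / β) := by field_simp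
  rw [h, Real.log_exp]
  field_simp
  ring

theorem eq_mul_exp_besselPhase (hβ : 0 < β) (hr₀ : 0 < r₀) {lam : ℝ} (hlam : 0 < lam) :
    lam = 2 / r₀ * Real.exp ((gammaPhase β - besselPhase β (lam * r₀)) / β) := by
  have h : (gammaPhase β - besselPhase β (lam * r₀)) / β = Real.log (lam * r₀ / 2) := by
    unfold besselPhase; field_simp; ring
  rw [h, Real.exp_log (by positivity)]
  field_simp

theorem leadingPart_eq_zero_iff (hβ : 0 < β) (hr₀ : 0 < r₀) {w₀ : ℝ → ℝ}
    (hw : complexCoeff β r₀ w₀ ≠ 0) {lam : ℝ} (hlam : 0 < lam) :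
    leadingPart β r₀ w₀ lam = 0 ↔ ∃ n : ℤ, lam = lamZero β r₀ w₀ n := by
  have hz : ∀ n : ℤ, lamZero β r₀ w₀ n = 2 / r₀ *
      Real.exp ((gammaPhase β - (alphaAngle β r₀ w₀ + n * Real.pi)) / β) := fun n => by
    simpa using lamZero_mul_exp_eq (β := β) (r₀ := r₀) w₀ n 0
  rw [leadingPart_eq_norm_mul_sin, mul_eq_zero, norm_eq_zero, or_iff_right hw,
    Real.sin_eq_zero_iff]
  constructor
  · rintro ⟨n, hn⟩
    -- The zero of the sine gives α - φ = nπ, whereas lam_m⁰ has phase α + mπ; hence the sign.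
    refine ⟨-n, ?_⟩
    rw [hz, eq_mul_exp_besselPhase hβ hr₀ hlam]
    congr 4
    push_cast
    linarith
  · rintro ⟨n, hn⟩
    refine ⟨-n, ?_⟩
    rw [hn, hz, besselPhase_mul_exp hβ hr₀]
    push_cast
    ring

theorem leadingPart_lamZero_mul_exp (hβ : 0 < β) (hr₀ : 0 < r₀) (w₀ : ℝ → ℝ) (n : ℤ) (η : ℝ) :
    leadingPart β r₀ w₀ (lamZero β r₀ w₀ n * Real.exp (η / β)) =
      ‖complexCoeff β r₀ w₀‖ * ((-1) ^ n * Real.sin η) := by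
  rw [leadingPart_eq_norm_mul_sin, lamZero_mul_exp_eq, besselPhase_mul_exp hβ hr₀,
    ← Real.sin_sub_int_mul_pi]
  congr 2
  ring

/-- The leading part contained in F contributes exactly sin η, so it cancels and only the
determinant term remains. -/
theorem IsPerturbedSolution.matchingDet_eq_zero (hβ : 0 < β) (hr₀ : 0 < r₀) {w : ℝ → ℝ → ℝ}
    (hw : complexCoeff β r₀ (w 0) ≠ 0) {n : ℤ} {η : ℝ} (h : IsPerturbedSolution β r₀ w n η) :
    matchingDet β r₀ (lamZero β r₀ (w 0) n * Real.exp (η / β))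
      (w (lamZero β r₀ (w 0) n * Real.exp (η / β))) = 0 := by
  have h1 := h.2
  rw [sqrt_coeff_eq_norm, remainderF, leadingPart_lamZero_mul_exp hβ hr₀, ← amplitude] at h1
  have hρ : ‖complexCoeff β r₀ (w 0)‖ ≠ 0 := norm_ne_zero_iff.2 hw
  have hA := (amplitude_pos hβ).ne'
  have hs : ((-1 : ℝ) ^ n) * (-1) ^ n = 1 := by
    rw [← mul_zpow]; simp
  have hs0 : ((-1 : ℝ) ^ n) ≠ 0 := left_ne_zero_of_mul_eq_one hs
  rw [mul_add, ← mul_assoc, div_mul_cancel₀ _ hρ, ← mul_assoc, hs, one_mul, left_eq_add] at h1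
  simpa [hρ, hA, hs0] using h1

/-! ### Size and Lipschitz constant of the perturbation -/

theorem norm_exp_mul_I_sub_le (x y : ℝ) :
    ‖Complex.exp (-((x : ℂ) * Complex.I)) - Complex.exp (-((y : ℂ) * Complex.I))‖ ≤ |x - y| := by
  have h : Complex.exp (-((x : ℂ) * Complex.I)) - Complex.exp (-((y : ℂ) * Complex.I)) =
      Complex.exp ((-y : ℝ) * Complex.I) *
        (Complex.exp (Complex.I * ((y - x : ℝ) : ℂ)) - 1) := by
    rw [mul_sub, ← Complex.exp_add, mul_one]
    congr 2 <;> (push_cast; ring)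
  rw [h, norm_mul, Complex.norm_exp_ofReal_mul_I, one_mul, abs_sub_comm]
  exact Real.norm_exp_I_mul_ofReal_sub_one_le

/-- The right-hand side of the perturbed equation. -/
def perturbation (β r₀ : ℝ) (w : ℝ → ℝ → ℝ) (n : ℤ) (η : ℝ) : ℝ :=
  (-1) ^ n / Real.sqrt (coeffA r₀ (w 0) ^ 2 + coeffB β r₀ (w 0) ^ 2) *
    remainderF β r₀ w (lamZero β r₀ (w 0) n * Real.exp (η / β))

theorem perturbation_eq (hβ : 0 < β) (hr₀ : 0 < r₀) (w : ℝ → ℝ → ℝ) (n : ℤ) (η : ℝ) :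
    perturbation β r₀ w n η = (-1) ^ n / ‖complexCoeff β r₀ (w 0)‖ *
      -(Complex.exp (-((alphaAngle β r₀ (w 0) + n * Real.pi - η : ℝ) * Complex.I)) *
        complexRemainder β r₀ w (lamZero β r₀ (w 0) n * Real.exp (η / β))).im := by
  rw [perturbation, sqrt_coeff_eq_norm, remainderF_eq_im hβ hr₀
    (mul_pos (lamZero_pos hr₀ _ _) (Real.exp_pos _))]
  nth_rewrite 1 [lamZero_mul_exp_eq]
  rw [besselPhase_mul_exp hβ hr₀]

section Estimates

variable {w : ℝ → ℝ → ℝ} {n : ℤ} {C X : ℝ}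

theorem perturbed_mem_Icc (hβ : 0 < β) (hr₀ : 0 < r₀)
    (hX : lamZero β r₀ (w 0) n * Real.exp (Real.pi / 2 / β) ≤ X)
    {η : ℝ} (hη : η ∈ Icc (-(Real.pi / 2)) (Real.pi / 2)) :
    lamZero β r₀ (w 0) n * Real.exp (η / β) ∈ Icc 0 X := by
  have h0 := lamZero_pos (β := β) hr₀ (w 0) n
  refine ⟨by positivity, le_trans ?_ hX⟩
  have := hη.2
  gcongr

theorem norm_complexRemainder_perturbed_le (hβ : 0 < β) (hr₀ : 0 < r₀) (hC : 0 ≤ C)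
    (hB : ∀ lam ∈ Icc (0 : ℝ) 1, ∀ kap ∈ Icc (0 : ℝ) 1,
      ‖complexRemainder β r₀ w lam - complexRemainder β r₀ w kap‖ ≤
        C * ‖complexCoeff β r₀ (w 0)‖ * |lam ^ 2 - kap ^ 2|)
    (hX : lamZero β r₀ (w 0) n * Real.exp (Real.pi / 2 / β) ≤ X) (hX1 : X ≤ 1)
    {η : ℝ} (hη : η ∈ Icc (-(Real.pi / 2)) (Real.pi / 2)) :
    ‖complexRemainder β r₀ w (lamZero β r₀ (w 0) n * Real.exp (η / β))‖ ≤
      C * ‖complexCoeff β r₀ (w 0)‖ * X ^ 2 := by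
  have hm := perturbed_mem_Icc hβ hr₀ hX hη
  have h := hB _ ⟨hm.1, hm.2.trans hX1⟩ 0 ⟨le_rfl, zero_le_one⟩
  rw [complexRemainder_zero, sub_zero] at h
  refine h.trans (mul_le_mul_of_nonneg_left ?_ (by positivity))
  rw [zero_pow two_ne_zero, sub_zero, abs_of_nonneg (sq_nonneg _)]
  exact pow_le_pow_left₀ hm.1 hm.2 2

theorem abs_perturbation_le (hβ : 0 < β) (hr₀ : 0 < r₀) (hC : 0 ≤ C)
    (hw : complexCoeff β r₀ (w 0) ≠ 0)
    (hB : ∀ lam ∈ Icc (0 : ℝ) 1, ∀ kap ∈ Icc (0 : ℝ) 1,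
      ‖complexRemainder β r₀ w lam - complexRemainder β r₀ w kap‖ ≤
        C * ‖complexCoeff β r₀ (w 0)‖ * |lam ^ 2 - kap ^ 2|)
    (hX : lamZero β r₀ (w 0) n * Real.exp (Real.pi / 2 / β) ≤ X) (hX1 : X ≤ 1)
    {η : ℝ} (hη : η ∈ Icc (-(Real.pi / 2)) (Real.pi / 2)) :
    |perturbation β r₀ w n η| ≤ C * X ^ 2 := by
  have hρ : 0 < ‖complexCoeff β r₀ (w 0)‖ := norm_pos_iff.2 hw
  rw [perturbation_eq hβ hr₀, abs_mul, abs_div, abs_zpow, abs_neg, abs_one, one_zpow, abs_norm,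
    abs_neg, one_div_mul_eq_div, div_le_iff₀ hρ]
  refine (Complex.abs_im_le_norm _).trans ?_
  rw [← neg_mul, ← Complex.ofReal_neg, norm_mul, Complex.norm_exp_ofReal_mul_I, one_mul]
  refine (norm_complexRemainder_perturbed_le hβ hr₀ hC hB hX hX1 hη).trans (le_of_eq ?_)
  ring

/-- Product rule in η: the rotation is 1-Lipschitz and contributes the 1, while lam² is proportional
to e^{2η/β} and contributes the 2/β. -/
theorem abs_perturbation_sub_le (hβ : 0 < β) (hr₀ : 0 < r₀) (hC : 0 ≤ C)
    (hw : complexCoeff β r₀ (w 0) ≠ 0)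
    (hB : ∀ lam ∈ Icc (0 : ℝ) 1, ∀ kap ∈ Icc (0 : ℝ) 1,
      ‖complexRemainder β r₀ w lam - complexRemainder β r₀ w kap‖ ≤
        C * ‖complexCoeff β r₀ (w 0)‖ * |lam ^ 2 - kap ^ 2|)
    (hX : lamZero β r₀ (w 0) n * Real.exp (Real.pi / 2 / β) ≤ X) (hX1 : X ≤ 1)
    {η ζ : ℝ} (hη : η ∈ Icc (-(Real.pi / 2)) (Real.pi / 2))
    (hζ : ζ ∈ Icc (-(Real.pi / 2)) (Real.pi / 2)) :
    |perturbation β r₀ w n η - perturbation β r₀ w n ζ| ≤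
      C * (1 + 2 / β) * X ^ 2 * |η - ζ| := by
  have hρ : 0 < ‖complexCoeff β r₀ (w 0)‖ := norm_pos_iff.2 hw
  have h0 := lamZero_pos (β := β) hr₀ (w 0) n
  rw [perturbation_eq hβ hr₀, perturbation_eq hβ hr₀, ← mul_sub, abs_mul, abs_div, abs_zpow,
    abs_neg, abs_one, one_zpow, abs_norm, one_div_mul_eq_div, div_le_iff₀ hρ, neg_sub_neg,
    ← Complex.sub_im]
  refine (Complex.abs_im_le_norm _).trans ?_
  have hmη := perturbed_mem_Icc hβ hr₀ hX hη
  have hmζ := perturbed_mem_Icc hβ hr₀ hX hζ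
  have hsq : |(lamZero β r₀ (w 0) n * Real.exp (ζ / β)) ^ 2 -
      (lamZero β r₀ (w 0) n * Real.exp (η / β)) ^ 2| ≤ X ^ 2 * (2 / β) * |η - ζ| := by
    have hE : ∀ y : ℝ, Real.exp (y / β) ^ 2 = Real.exp (2 * y / β) := fun y => by
      rw [← Real.exp_nat_mul]; congr 1; push_cast; ring
    have hle : ∀ y ∈ Icc (-(Real.pi / 2)) (Real.pi / 2),
        2 * y / β ≤ 2 * (Real.pi / 2) / β := fun y hy => by
      have := hy.2
      gcongr
    rw [mul_pow, mul_pow, ← mul_sub, abs_mul, abs_of_nonneg (sq_nonneg _), hE, hE]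
    have h1 := abs_exp_sub_exp_le (hle ζ hζ) (hle η hη)
    rw [← hE (Real.pi / 2), ← sub_div, ← mul_sub, abs_div, abs_mul, abs_two, abs_of_pos hβ,
      abs_sub_comm ζ η] at h1
    calc _ ≤ lamZero β r₀ (w 0) n ^ 2 *
          (Real.exp (Real.pi / 2 / β) ^ 2 * (2 * |η - ζ| / β)) := by gcongr
      _ = (lamZero β r₀ (w 0) n * Real.exp (Real.pi / 2 / β)) ^ 2 * (2 / β) * |η - ζ| := by
        ring
      _ ≤ _ := by gcongr
  have hrot : ∀ y : ℝ, ‖Complex.exp (-((y : ℂ) * Complex.I))‖ ≤ 1 := fun y => by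
    rw [← neg_mul, ← Complex.ofReal_neg, Complex.norm_exp_ofReal_mul_I]
  have h2 := norm_mul_sub_mul_le (hrot (alphaAngle β r₀ (w 0) + n * Real.pi - η))
    (norm_complexRemainder_perturbed_le hβ hr₀ hC hB hX hX1 hζ)
    (norm_exp_mul_I_sub_le (alphaAngle β r₀ (w 0) + n * Real.pi - ζ) _)
    (hB _ ⟨hmζ.1, hmζ.2.trans hX1⟩ _ ⟨hmη.1, hmη.2.trans hX1⟩)
  refine h2.trans ?_
  rw [sub_sub_sub_cancel_left, one_mul]
  calc _ ≤ |η - ζ| * (C * ‖complexCoeff β r₀ (w 0)‖ * X ^ 2) +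
        C * ‖complexCoeff β r₀ (w 0)‖ * (X ^ 2 * (2 / β) * |η - ζ|) := by gcongr
    _ = _ := by ring

theorem exists_unique_isPerturbedSolution (hβ : 0 < β) (hr₀ : 0 < r₀) (hC : 0 ≤ C)
    (hw : complexCoeff β r₀ (w 0) ≠ 0)
    (hB : ∀ lam ∈ Icc (0 : ℝ) 1, ∀ kap ∈ Icc (0 : ℝ) 1,
      ‖complexRemainder β r₀ w lam - complexRemainder β r₀ w kap‖ ≤
        C * ‖complexCoeff β r₀ (w 0)‖ * |lam ^ 2 - kap ^ 2|)
    (hX : lamZero β r₀ (w 0) n * Real.exp (Real.pi / 2 / β) ≤ X) (hX1 : X ≤ 1)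
    (hε : C * (1 + 2 / β) * X ^ 2 ≤ 1 / 4) :
    ∃ η : ℝ, IsPerturbedSolution β r₀ w n η ∧
      |η| ≤ Real.pi / 2 * (C * (1 + 2 / β) * X ^ 2) ∧
      ∀ x, IsPerturbedSolution β r₀ w n x → x = η := by
  obtain ⟨η, hη, h1, h2, h3⟩ := exists_unique_sin_eq (G := perturbation β r₀ w n) hε
    (fun x hx => (abs_perturbation_le hβ hr₀ hC hw hB hX hX1 hx).trans (by
      have : 0 ≤ C * (2 / β) * X ^ 2 := by positivity
      linarith))
    (fun x hx y hy => abs_perturbation_sub_le hβ hr₀ hC hw hB hX hX1 hx hy)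
  exact ⟨η, ⟨hη, h1⟩, h2, fun x hx => h3 x hx.1 hx.2⟩

end Estimates

/-! ### Uniformity in the solution, and infinitude -/

/-- An upper bound, uniform in the inner solution, for the numbers `lam_n⁰ e^{η/β}` with
`η ≤ π/2`. -/
def lamBound (β r₀ : ℝ) (n : ℤ) : ℝ :=
  2 / r₀ * Real.exp (2 * Real.pi / β) * Real.exp (Real.pi / 2 / β) *
    Real.exp (-(n * (Real.pi / β)))

theorem lamZero_mul_exp_le_lamBound (hβ : 0 < β) (hr₀ : 0 < r₀) (w₀ : ℝ → ℝ) (n : ℤ) :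
    lamZero β r₀ w₀ n * Real.exp (Real.pi / 2 / β) ≤ lamBound β r₀ n := by
  -- Both angles lie in (-π, π], which removes the dependence on w₀ through α.
  have h1 : gammaPhase β - alphaAngle β r₀ w₀ ≤ 2 * Real.pi := by
    have := Complex.arg_le_pi (Complex.Gamma (1 + β * Complex.I))
    have := Complex.neg_pi_lt_arg (⟨coeffA r₀ w₀, coeffB β r₀ w₀⟩ : ℂ)
    unfold gammaPhase alphaAngle
    linarith
  rw [lamZero, lamBound, mul_right_comm]
  gcongr

theorem tendsto_lamBound (hβ : 0 < β) (r₀ : ℝ) : Tendsto (lamBound β r₀) atTop (𝓝 0) := by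
  have h : Tendsto (fun n : ℤ => (n : ℝ) * (Real.pi / β)) atTop atTop :=
    tendsto_intCast_atTop_atTop.atTop_mul_const (div_pos Real.pi_pos hβ)
  simpa [lamBound, Function.comp_def] using! (Real.tendsto_exp_neg_atTop_nhds_zero.comp h).const_mul
    (2 / r₀ * Real.exp (2 * Real.pi / β) * Real.exp (Real.pi / 2 / β))

/-- Equal values have equal phases α + nπ - η_n, and |η_n - η_m| < π then forces n = m. -/
theorem infinite_perturbed (hβ : 0 < β) (hr₀ : 0 < r₀) (w₀ : ℝ → ℝ) (n₀ : ℤ) {η : ℤ → ℝ}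
    (hη : ∀ n, n₀ ≤ n → η n ∈ Ioo (-(Real.pi / 2)) (Real.pi / 2)) :
    {lam : ℝ | ∃ n : ℤ, n₀ ≤ n ∧
      lam = lamZero β r₀ w₀ n * Real.exp (η n / β)}.Infinite := by
  have hinj : InjOn (fun n : ℤ => lamZero β r₀ w₀ n * Real.exp (η n / β)) (Ici n₀) := by
    intro n hn m hm h
    simp only at h
    have h1 := congrArg (fun lam => besselPhase β (lam * r₀)) h
    simp only [lamZero_mul_exp_eq, besselPhase_mul_exp hβ hr₀] at h1
    have hn' := hη n hn
    have hm' := hη m hm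
    have hpi := Real.pi_pos
    have h2 : ((n : ℝ) - m) * Real.pi = η n - η m := by linarith
    have h3 : ((n : ℝ) - m) < 1 := by
      by_contra hc
      nlinarith [hn'.2, hm'.1]
    have h4 : -1 < ((n : ℝ) - m) := by
      by_contra hc
      nlinarith [hn'.1, hm'.2]
    have h5 : n - m < 1 := by exact_mod_cast h3
    have h6 : -1 < n - m := by exact_mod_cast h4
    omega
  refine ((Set.Ici_infinite n₀).image hinj).mono ?_
  rintro _ ⟨n, hn, rfl⟩
  exact ⟨n, hn, rfl⟩

end Efimov

end

/-! ### The proposition -/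

theorem proposition3p1
    (μ ν r₀ : ℝ) (hμ : 0 < μ) (hν : 0 < ν) (hr₀ : 0 < r₀)
    (hβ : 1 / 4 < μ * Efimov.lambertW 1 ^ 2 / ν)
    (θ : ℝ → ℝ) (hθ : ContDiffOn ℝ ∞ θ (Set.Ici 0)) (hθ₀ : θ 0 = 1)
    (hθ₁ : ∀ r, r₀ ≤ r → θ r = 0) :
    ∃ n₀ : ℤ, ∀ (c : ℝ) (w : ℝ → ℝ → ℝ), c ≠ 0 →
      (∀ lam : ℝ, 0 ≤ lam →
        Efimov.IsInnerSolution (fun r => μ * Efimov.effectiveEnergy ν θ r) r₀ c lam (w lam)) →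
      (∀ lam : ℝ, 0 < lam →
        (Efimov.leadingPart (Efimov.betaParam μ ν) r₀ (w 0) lam = 0 ↔
          ∃ n : ℤ, lam = Efimov.lamZero (Efimov.betaParam μ ν) r₀ (w 0) n)) ∧
      ∃ η : ℤ → ℝ,
        (∀ n : ℤ, n₀ ≤ n →
          Efimov.IsPerturbedSolution (Efimov.betaParam μ ν) r₀ w n (η n) ∧
          ∀ x : ℝ, Efimov.IsPerturbedSolution (Efimov.betaParam μ ν) r₀ w n x → x = η n) ∧
        Tendsto η atTop (𝓝 0) ∧
        (∀ n : ℤ, n₀ ≤ n →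
          Efimov.matchingDet (Efimov.betaParam μ ν) r₀
            (Efimov.lamZero (Efimov.betaParam μ ν) r₀ (w 0) n *
              Real.exp (η n / Efimov.betaParam μ ν))
            (w (Efimov.lamZero (Efimov.betaParam μ ν) r₀ (w 0) n *
              Real.exp (η n / Efimov.betaParam μ ν))) = 0) ∧
        {lam : ℝ | ∃ n : ℤ, n₀ ≤ n ∧
          lam = Efimov.lamZero (Efimov.betaParam μ ν) r₀ (w 0) n *
            Real.exp (η n / Efimov.betaParam μ ν)}.Infinite := by
  have hβ0 : 0 < Efimov.betaParam μ ν := Real.sqrt_pos.2 (by linarith)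
  obtain ⟨V, hV⟩ := Efimov.exists_abs_mul_effectiveEnergy_le (μ := μ) (r₀ := r₀) hν hθ hθ₀
  obtain ⟨C₁, hC₁, hB⟩ := Efimov.exists_norm_complexRemainder_sub_le hβ0 hr₀ hV
  obtain ⟨C₂, hC₂, hc⟩ := Efimov.exists_abs_le_norm_complexCoeff hβ0 hr₀ hV
  set β := Efimov.betaParam μ ν
  have hX := Efimov.tendsto_lamBound hβ0 r₀
  have hε : Tendsto (fun n => C₁ * C₂ * (1 + 2 / β) * Efimov.lamBound β r₀ n ^ 2) atTop
      (𝓝 0) := by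
    simpa using (hX.pow 2).const_mul (C₁ * C₂ * (1 + 2 / β))
  -- The threshold uses only `lamBound` and the constants C₁, C₂, β, all available before c and w
  -- are introduced.
  obtain ⟨n₀, hn₀⟩ := eventually_atTop.1 ((hX.eventually_le_const one_pos).and
    (hε.eventually_le_const (show (0 : ℝ) < 1 / 4 by norm_num)))
  refine ⟨n₀, fun c w hc0 hw => ?_⟩
  have hcw := hc c (w 0) (hw 0 le_rfl)
  have hne : Efimov.complexCoeff β r₀ (w 0) ≠ 0 := fun h => by
    rw [h, norm_zero, mul_zero] at hcw
    exact hc0 (abs_nonpos_iff.1 hcw)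
  have hBw : ∀ lam ∈ Icc (0 : ℝ) 1, ∀ kap ∈ Icc (0 : ℝ) 1,
      ‖Efimov.complexRemainder β r₀ w lam - Efimov.complexRemainder β r₀ w kap‖ ≤
        C₁ * C₂ * ‖Efimov.complexCoeff β r₀ (w 0)‖ * |lam ^ 2 - kap ^ 2| :=
    fun lam hlam kap hkap => (hB c w hw lam hlam kap hkap).trans (by
      rw [mul_assoc C₁ C₂]
      gcongr)
  have hsol := fun (n : ℤ) (hn : n₀ ≤ n) =>
    Efimov.exists_unique_isPerturbedSolution hβ0 hr₀ (mul_nonneg hC₁ hC₂) hne hBw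
      (Efimov.lamZero_mul_exp_le_lamBound hβ0 hr₀ (w 0) n) (hn₀ n hn).1 (hn₀ n hn).2
  -- Below n₀ the values of η are arbitrary; all conclusions concern n ≥ n₀ or the limit at
  -- infinity.
  choose! η hη using hsol
  refine ⟨fun lam hlam => Efimov.leadingPart_eq_zero_iff hβ0 hr₀ hne hlam, η,
    fun n hn => ⟨(hη n hn).1, (hη n hn).2.2⟩, ?_,
    fun n hn => (hη n hn).1.matchingDet_eq_zero hβ0 hr₀ hne,
    Efimov.infinite_perturbed hβ0 hr₀ (w 0) n₀ fun n hn => (hη n hn).1.1⟩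
  refine squeeze_zero_norm' ?_ (by simpa using hε.const_mul (Real.pi / 2))
  filter_upwards [eventually_ge_atTop n₀] with n hn
  exact (hη n hn).2.1
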